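/- Let $A$ be a unital $C^*$-algebra and let $B\subset A$ be a $C^*$-subalgebra containing the unit of $A$, with both $A$ and $B$ simple (nonzero, with no closed two-sided ideals other than $0$ and the whole algebra). For a unital inclusion $B\subset D$ of $C^*$-algebras put $\mathcal N_D(B)=\{u\in\mathcal U(D): uBu^*=B\}$, where $\mathcal U(D)$ is the unitary group of $D$, and call the inclusion regular if $\mathcal N_D(B)$ generates $D$ as a $C^*$-algebra. Suppose that $B\subset A$ is regular, that it is irreducible, i.e. $B'\cap A=\mathbb C1$, and that there exists a conditional expectation $E:A\to B$ (a positive linear map with $E(b)=b$, $E(ba)=bE(a)$ and $E(ab)=E(a)b$ for all $a\in A$, $b\in B$). Then for every intermediate $C^*$-algebra $B\subset C\subset A$, the inclusion $B\subset C$ is regular. -/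

import Mathlib

namespace RegularInclusion

/-- A unital C*-algebra is simple when it is nonzero and its only norm-closed two-sided ideals
are zero and the whole algebra. -/
def IsSimpleCStar (A : Type*) [Ring A] [TopologicalSpace A] : Prop :=
  Nontrivial A ∧ ∀ I : TwoSidedIdeal A, IsClosed (I : Set A) → I = ⊥ ∨ I = ⊤

section

variable {A : Type*} [Ring A] [StarRing A] [Algebra ℂ A] [StarModule ℂ A]

/-- The unitary normalizer `{u ∈ U(A) : u B u* = B}` of a unital *-subalgebra `B` of `A`. -/
def unitaryNormalizer (B : StarSubalgebra ℂ A) : Set A :=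
  {u | u ∈ unitary A ∧ (fun b => u * b * star u) '' (B : Set A) = (B : Set A)}

/-- The inclusion `B ⊂ A` is regular when the unitary normalizer of `B` in `A` generates `A` as a
C*-algebra: the closure of the *-algebra it generates is all of `A`. -/
def IsRegular [TopologicalSpace A] [IsTopologicalRing A] [ContinuousStar A]
    (B : StarSubalgebra ℂ A) : Prop :=
  (StarAlgebra.adjoin ℂ (unitaryNormalizer B)).topologicalClosure = ⊤

/-- The inclusion `B ⊂ A` is irreducible when the relative commutant `B' ∩ A` consists of the
scalar multiples of the unit. -/
def IsIrreducible (B : StarSubalgebra ℂ A) : Prop :=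
  StarSubalgebra.centralizer ℂ (B : Set A) = ⊥

/-- A conditional expectation from `A` onto `B`: a positive linear `B`-bimodule map that restricts
to the identity on `B`. (The positive elements of a C*-algebra are those of the form `c* c`.)
It is not required to be faithful. -/
structure IsConditionalExpectation (B : StarSubalgebra ℂ A) (E : A →ₗ[ℂ] B) : Prop where
  map_coe : ∀ b : B, E (b : A) = b
  map_mul_left : ∀ (b : B) (a : A), E ((b : A) * a) = b * E a
  map_mul_right : ∀ (a : A) (b : B), E (a * (b : A)) = E a * b
  map_nonneg : ∀ a : A, ∃ c : B, E (star a * a) = star c * c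

end

end RegularInclusion

/-! Write `N` for the unitary normalizer of `B` in `A`. Irreducibility makes `star u * E u` scalar
for `u ∈ N`, so `E` kills `N \ B`. Moreover `E` is faithful: the `a` with `E (x * a * y) = 0` for
all `x`, `y` form a proper closed ideal of the simple algebra `A` (`IsCondExp.faithful`). By
regularity an element `a` is then determined by its coefficients `E (a * star u)`, `u ∈ N`.

Averaging: if `u ∈ N \ B`, unital maps `x ↦ ∑ c * x * star c` with `c ∈ B` push elements of `B u` to
zero (`exists_ucp_norm_lt`). Otherwise almost minimal elements of an orbit converge, by a
parallelogram estimate relying on simplicity of `B`, to a nonzero element of `B u` commuting with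
`B`, hence scalar, which forces `u ∈ B`. Consequently `x - E x` averages to zero for every `x`. If
`x ∈ C` and `E (x * star u) ≠ 0`, simplicity of `B` yields `y` with `y * u ∈ C` and `E y = 1`;
averaging `y` to `1` puts `u` in `C` (`mem_of_map_mul_star_ne_zero`).

Conclusion: approximate `x ∈ C` by `y n + w n`, with `y n` in the span of `N ∩ C` and `w n` in the
span of `N \ C`. Dropping `w n` is contractive (`norm_le_norm_add`), so `y n` converges to some `d ∈
C`. All coefficients of `x - d` vanish, and faithfulness gives `x = d`. -/

namespace RegularInclusion

/-! ### Elementary completely positive maps with coefficients in `B` -/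

section Cone

variable {A : Type*} [CStarAlgebra A]

/-- The map `x ↦ c * x * star c`. -/
noncomputable def conj (c : A) : A →ₗ[ℂ] A :=
  LinearMap.mulLeft ℂ c ∘ₗ LinearMap.mulRight ℂ (star c)

lemma conj_apply (c x : A) : conj c x = c * x * star c := by
  simp [conj, mul_assoc]

/-- The cone of elementary completely positive maps `x ↦ ∑ c * x * star c` with coefficients in
`B`. -/
noncomputable def cone (B : StarSubalgebra ℂ A) : AddSubmonoid (A →ₗ[ℂ] A) :=
  AddSubmonoid.closure (conj '' (B : Set A))

/-- The elementary unital completely positive maps with coefficients in `B`. -/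
def ucp (B : StarSubalgebra ℂ A) : Set (A →ₗ[ℂ] A) :=
  {T | T ∈ cone B ∧ T 1 = 1}

variable {B : StarSubalgebra ℂ A}

lemma conj_mem_cone {c : A} (hc : c ∈ B) : conj c ∈ cone B :=
  AddSubmonoid.subset_closure ⟨c, hc, rfl⟩

lemma comp_conj_mem_cone {T : A →ₗ[ℂ] A} (hT : T ∈ cone B) {c : A} (hc : c ∈ B) :
    T ∘ₗ conj c ∈ cone B := by
  refine AddSubmonoid.closure_induction (motive := fun T _ => T ∘ₗ conj c ∈ cone B)
    ?_ ?_ ?_ hT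
  · rintro _ ⟨b, hb, rfl⟩
    have : conj b ∘ₗ conj c = conj (b * c) := by
      ext x; simp [conj_apply, mul_assoc]
    rw [this]
    exact conj_mem_cone (mul_mem hb hc)
  · simp [zero_mem]
  · intro S T _ _ hS hT
    rw [LinearMap.add_comp]
    exact add_mem hS hT

lemma comp_mem_cone {S T : A →ₗ[ℂ] A} (hS : S ∈ cone B) (hT : T ∈ cone B) :
    S ∘ₗ T ∈ cone B := by
  refine AddSubmonoid.closure_induction (motive := fun T _ => S ∘ₗ T ∈ cone B) ?_ ?_ ?_ hT
  · rintro _ ⟨b, hb, rfl⟩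
    exact comp_conj_mem_cone hS hb
  · simp [zero_mem]
  · intro T T' _ _ hT hT'
    rw [LinearMap.comp_add]
    exact add_mem hT hT'

lemma comp_mem_ucp {S T : A →ₗ[ℂ] A} (hS : S ∈ ucp B) (hT : T ∈ ucp B) : S ∘ₗ T ∈ ucp B :=
  ⟨comp_mem_cone hS.1 hT.1, by simp [hS.2, hT.2]⟩

lemma conj_mem_ucp {v : A} (hv : v ∈ unitary A) (hvB : v ∈ B) : conj v ∈ ucp B :=
  ⟨conj_mem_cone hvB, by simp [conj_apply, (Unitary.mem_iff.1 hv).2]⟩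

lemma id_mem_ucp : LinearMap.id ∈ ucp B := by
  have : conj (1 : A) = LinearMap.id := by ext; simp [conj_apply]
  exact this ▸ conj_mem_ucp (one_mem _) (one_mem B)

/-- Positive scalars are absorbed into the coefficients through their square roots. The factor one
half suffices: only midpoints are needed in the parallelogram argument. -/
lemma half_smul_mem_cone {T : A →ₗ[ℂ] A} (hT : T ∈ cone B) : (2⁻¹ : ℂ) • T ∈ cone B := by
  have h : (2⁻¹ : ℂ) • T = T ∘ₗ conj (algebraMap ℂ A (Real.sqrt 2⁻¹ : ℝ)) := by
    ext x
    have : ((Real.sqrt 2⁻¹ : ℝ) : ℂ) * ((Real.sqrt 2⁻¹ : ℝ) : ℂ) = 2⁻¹ := by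
      rw [← Complex.ofReal_mul, Real.mul_self_sqrt (by norm_num)]
      norm_num
    rw [LinearMap.comp_apply, conj_apply, ← algebraMap_star_comm, mul_assoc,
      ← Algebra.commutes _ x, ← mul_assoc, ← map_mul, Complex.star_def, Complex.conj_ofReal, this,
      ← Algebra.smul_def, map_smul, LinearMap.smul_apply]
  rw [h]
  exact comp_conj_mem_cone hT (algebraMap_mem B _)

lemma half_add_mem_ucp {S T : A →ₗ[ℂ] A} (hS : S ∈ ucp B) (hT : T ∈ ucp B) :
    (2⁻¹ : ℂ) • (S + T) ∈ ucp B := by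
  refine ⟨half_smul_mem_cone (add_mem hS.1 hT.1), ?_⟩
  rw [LinearMap.smul_apply, LinearMap.add_apply, hS.2, hT.2, ← two_smul ℂ (1 : A), smul_smul]
  norm_num

lemma cone_apply_mem {T : A →ₗ[ℂ] A} (hT : T ∈ cone B) {x : A} (hx : x ∈ B) : T x ∈ B := by
  refine AddSubmonoid.closure_induction (motive := fun T _ => T x ∈ B) ?_ ?_ ?_ hT
  · rintro _ ⟨b, hb, rfl⟩
    rw [conj_apply]
    exact mul_mem (mul_mem hb hx) (star_mem hb)
  · simp [zero_mem]
  · intro S T _ _ hS hT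
    exact add_mem hS hT

lemma algebraMap_real_eq_smul (r : ℝ) : algebraMap ℝ A r = (r : ℂ) • (1 : A) := by
  rw [Algebra.algebraMap_eq_smul_one]
  exact (Complex.coe_smul r (1 : A)).symm

lemma map_algebraMap_real (T : A →ₗ[ℂ] A) (r : ℝ) :
    T (algebraMap ℝ A r) = (r : ℂ) • T 1 := by
  rw [algebraMap_real_eq_smul, map_smul]

variable [PartialOrder A] [StarOrderedRing A]

lemma cone_apply_nonneg {T : A →ₗ[ℂ] A} (hT : T ∈ cone B) {x : A} (hx : 0 ≤ x) : 0 ≤ T x := by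
  refine AddSubmonoid.closure_induction (motive := fun T _ => 0 ≤ T x) ?_ ?_ ?_ hT
  · rintro _ ⟨b, hb, rfl⟩
    rw [conj_apply]
    exact star_right_conjugate_nonneg hx b
  · simp
  · intro S T _ _ hS hT
    exact add_nonneg hS hT

lemma cone_apply_mono {T : A →ₗ[ℂ] A} (hT : T ∈ cone B) {x y : A} (h : x ≤ y) : T x ≤ T y := by
  rw [← sub_nonneg, ← map_sub]
  exact cone_apply_nonneg hT (sub_nonneg.2 h)

/-- The Kadison–Schwarz inequality. -/
lemma ucp_schwarz {T : A →ₗ[ℂ] A} (hT : T ∈ ucp B) (y : A) :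
    T y * star (T y) ≤ T (y * star y) := by
  -- For `T = conj b` the expression is `(b * y - w * b) * star (b * y - w * b)`. It is additive in
  -- `T`, which the Schwarz inequality itself is not, so induction applies; then `w = T y`.
  have key : ∀ w : A, 0 ≤ T (y * star y) - T y * star w - w * T (star y) + w * T 1 * star w ∧
      T (star y) = star (T y) := by
    intro w
    refine AddSubmonoid.closure_induction
      (motive := fun T _ => 0 ≤ T (y * star y) - T y * star w - w * T (star y) + w * T 1 * star w ∧
        T (star y) = star (T y)) ?_ ?_ ?_ hT.1
    · rintro _ ⟨b, hb, rfl⟩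
      simp only [conj_apply]
      refine ⟨?_, by simp [mul_assoc]⟩
      convert mul_star_self_nonneg (b * y - w * b) using 1
      simp only [star_sub, star_mul]
      noncomm_ring
    · simp
    · intro S T _ _ hS hT
      refine ⟨?_, by simp [hS.2, hT.2]⟩
      convert add_nonneg hS.1 hT.1 using 1
      simp only [LinearMap.add_apply]
      noncomm_ring
  have h := (key (T y)).1
  rw [(key 0).2, hT.2] at h
  rw [← sub_nonneg]
  simpa using h

lemma norm_sq_le_of_mul_star_le {x : A} {r : ℝ} (hr : 0 ≤ r)
    (h : x * star x ≤ algebraMap ℝ A r) : ‖x‖ ^ 2 ≤ r := by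
  rw [sq, ← CStarRing.norm_self_mul_star]
  exact (CStarAlgebra.norm_le_iff_le_algebraMap _ hr (mul_star_self_nonneg x)).2 h

lemma ucp_norm_le {T : A →ₗ[ℂ] A} (hT : T ∈ ucp B) (y : A) : ‖T y‖ ≤ ‖y‖ := by
  refine le_of_sq_le_sq ?_ (norm_nonneg y)
  refine norm_sq_le_of_mul_star_le (by positivity) ((ucp_schwarz hT y).trans ?_)
  refine (cone_apply_mono hT.1 CStarAlgebra.mul_star_le_algebraMap_norm_sq).trans ?_
  rw [map_algebraMap_real, hT.2, algebraMap_real_eq_smul]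

end Cone

/-! ### Consequences of simplicity -/

section Simple

variable {A : Type*} [CStarAlgebra A] {B : StarSubalgebra ℂ A}

/-- In a simple unital C*-algebra, every nonzero element generates the whole algebra as an
(algebraic) two-sided ideal. -/
lemma IsSimpleCStar.one_mem_closure {D : Type*} [CStarAlgebra D] (hD : IsSimpleCStar D) {f : D}
    (hf : f ≠ 0) : (1 : D) ∈ AddSubgroup.closure {x | ∃ p q : D, x = p * f * q} := by
  set J := AddSubgroup.closure {x | ∃ p q : D, x = p * f * q} with hJ
  have hl : ∀ x y : D, y ∈ J → x * y ∈ J := by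
    intro x y hy
    refine AddSubgroup.closure_induction (p := fun y _ => x * y ∈ J) ?_ ?_ ?_ ?_ hy
    · rintro _ ⟨p, q, rfl⟩
      exact AddSubgroup.subset_closure ⟨x * p, q, by simp [mul_assoc]⟩
    · simp [zero_mem]
    · intro y z _ _ hy hz
      rw [mul_add]
      exact add_mem hy hz
    · intro y _ hy
      rw [mul_neg]
      exact neg_mem hy
  have hr : ∀ x y : D, y ∈ J → y * x ∈ J := by
    intro x y hy
    refine AddSubgroup.closure_induction (p := fun y _ => y * x ∈ J) ?_ ?_ ?_ ?_ hy
    · rintro _ ⟨p, q, rfl⟩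
      exact AddSubgroup.subset_closure ⟨p, q * x, by simp [mul_assoc]⟩
    · simp [zero_mem]
    · intro y z _ _ hy hz
      rw [add_mul]
      exact add_mem hy hz
    · intro y _ hy
      rw [neg_mul]
      exact neg_mem hy
  let I : TwoSidedIdeal D := TwoSidedIdeal.mk' (J.topologicalClosure : Set D)
    (zero_mem _) (fun hx hy => add_mem hx hy) (fun hx => neg_mem hx)
    (fun {x y} hy => map_mem_closure (f := fun y => x * y) (by fun_prop) hy fun y hy => hl x y hy)
    (fun {y x} hy => map_mem_closure (f := fun y => y * x) (by fun_prop) hy fun y hy => hr x y hy)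
  have hI : (I : Set D) = J.topologicalClosure := TwoSidedIdeal.coe_mk' _ _ _ _ _ _
  have hfI : f ∈ I := by
    rw [← SetLike.mem_coe, hI]
    exact subset_closure (AddSubgroup.subset_closure ⟨1, 1, by simp⟩)
  rcases hD.2 I (by rw [hI]; exact isClosed_closure) with h | h
  · rw [h] at hfI
    exact absurd ((TwoSidedIdeal.mem_bot D).1 hfI) hf
  · have h1 : (1 : D) ∈ closure (J : Set D) := by
      have : (1 : D) ∈ (I : Set D) := by rw [h]; trivial
      rw [hI] at this
      exact this
    -- An element of the ideal at distance less than 1 from the unit is invertible, so no closure is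
    -- needed.
    obtain ⟨j, hj, hj1⟩ := Metric.mem_closure_iff.1 h1 1 one_pos
    rw [dist_eq_norm] at hj1
    let w := Units.oneSub (1 - j) hj1
    have hw : (w : D) = j := by simp [w]
    have := hl (↑w⁻¹ : D) j hj
    rwa [← hw, Units.inv_mul] at this

lemma exists_mem_ideal (hBc : IsClosed (B : Set A)) (hB : IsSimpleCStar B) {f : A} (hfB : f ∈ B)
    (hf : f ≠ 0) : (1 : A) ∈ AddSubgroup.closure {x | ∃ p ∈ B, ∃ q ∈ B, x = p * f * q} := by
  have : IsClosed (B : Set A) := hBc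
  have h := IsSimpleCStar.one_mem_closure (D := B) hB (f := ⟨f, hfB⟩)
    (fun h => hf (congrArg Subtype.val h))
  have h2 := AddSubgroup.mem_map_of_mem (B.subtype : B →+ A) h
  rw [AddMonoidHom.map_closure] at h2
  refine AddSubgroup.closure_mono ?_ h2
  rintro _ ⟨_, ⟨p, q, rfl⟩, rfl⟩
  exact ⟨p, p.2, q, q.2, rfl⟩

variable [PartialOrder A] [StarOrderedRing A]

/-- Symmetrizing an identity `1 = ∑ p * f * q` bounds `T f` below by a positive scalar for some `T`
in the cone; conjugating by the inverse square root of `T f` normalizes the value to `1`. -/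
lemma exists_cone_apply_eq_one (hBc : IsClosed (B : Set A)) (hB : IsSimpleCStar B) {f : A}
    (hfB : f ∈ B) (hf : f ≠ 0) (hf0 : 0 ≤ f) : ∃ T ∈ cone B, T f = 1 := by
  -- Expanding `(p ∓ star q) * f * star (p ∓ star q) ≥ 0` bounds `±(t + star t)` for a generator
  -- `t`. Both signs are carried so that the bound survives negation.
  have key : ∀ t ∈ AddSubgroup.closure {x | ∃ p ∈ B, ∃ q ∈ B, x = p * f * q},
      ∃ T ∈ cone B, t + star t ≤ T f ∧ -(t + star t) ≤ T f := by
    intro t ht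
    have hfs : star f = f := hf0.isSelfAdjoint
    refine AddSubgroup.closure_induction
      (p := fun t _ => ∃ T ∈ cone B, t + star t ≤ T f ∧ -(t + star t) ≤ T f) ?_ ?_ ?_ ?_ ht
    · rintro _ ⟨p, hp, q, hq, rfl⟩
      refine ⟨conj p + conj (star q), add_mem (conj_mem_cone hp) (conj_mem_cone (star_mem hq)),
        ?_, ?_⟩
      · rw [← sub_nonneg]
        convert star_right_conjugate_nonneg hf0 (p - star q) using 1
        simp only [LinearMap.add_apply, conj_apply, star_sub, star_star, star_mul, hfs]
        noncomm_ring
      · rw [← sub_nonneg]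
        convert star_right_conjugate_nonneg hf0 (p + star q) using 1
        simp only [LinearMap.add_apply, conj_apply, star_add, star_star, star_mul, hfs]
        noncomm_ring
    · exact ⟨0, zero_mem _, by simp, by simp⟩
    · rintro x y _ _ ⟨S, hS, h1, h2⟩ ⟨T, hT, h3, h4⟩
      refine ⟨S + T, add_mem hS hT, ?_, ?_⟩
      · convert add_le_add h1 h3 using 1 <;>
          simp only [star_add, LinearMap.add_apply]
        abel
      · convert add_le_add h2 h4 using 1 <;>
          simp only [star_add, LinearMap.add_apply]
        abel
    · rintro x _ ⟨T, hT, h1, h2⟩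
      refine ⟨T, hT, ?_, ?_⟩
      · convert h2 using 1
        rw [star_neg]; abel
      · convert h1 using 1
        rw [star_neg]; abel
  obtain ⟨T, hT, h, -⟩ := key 1 (exists_mem_ideal hBc hB hfB hf)
  have h1 : (1 : A) ≤ T f := by
    refine le_trans ?_ h
    rw [star_one]
    exact le_add_of_nonneg_right zero_le_one
  have hsp : IsStrictlyPositive (T f) := IsStrictlyPositive.of_le isStrictlyPositive_one h1
  have hTB : T f ∈ B := cone_apply_mem hT hfB
  have hmem : (T f) ^ (-(1 / 2) : ℝ) ∈ B := by
    have : IsClosed (B : Set A) := hBc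
    rw [CFC.rpow_def, cfc_nnreal_eq_real _ _ hsp.nonneg]
    exact cfc_mem _ hTB
  refine ⟨conj ((T f) ^ (-(1 / 2) : ℝ)) ∘ₗ T, comp_mem_cone (conj_mem_cone hmem) hT, ?_⟩
  rw [LinearMap.comp_apply, conj_apply, (CFC.rpow_nonneg.isSelfAdjoint :
    IsSelfAdjoint ((T f) ^ (-(1 / 2) : ℝ)))]
  exact CFC.conjugate_rpow_neg_one_half _ hsp

end Simple

/-! ### Averaging `B u` to zero for a normalizing unitary `u` outside `B` -/

section Outer

variable {A : Type*} [CStarAlgebra A] {B : StarSubalgebra ℂ A}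

lemma conj_mem_of_mem_normalizer {u b : A} (hu : u ∈ unitaryNormalizer B) (hb : b ∈ B) :
    u * b * star u ∈ B := by
  have : u * b * star u ∈ (fun b => u * b * star u) '' (B : Set A) := ⟨b, hb, rfl⟩
  rwa [hu.2] at this

lemma star_mem_normalizer {u : A} (hu : u ∈ unitaryNormalizer B) :
    star u ∈ unitaryNormalizer B := by
  have h1 := (Unitary.mem_iff.1 hu.1).1
  refine ⟨Unitary.star_mem hu.1, ?_⟩
  nth_rewrite 1 [← hu.2]
  rw [Set.image_image]
  convert Set.image_id (B : Set A) using 1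
  refine Set.image_congr fun b _ => ?_
  calc star u * (u * b * star u) * star (star u) = (star u * u) * b * (star u * u) := by
        simp only [star_star, mul_assoc]
    _ = b := by rw [h1, one_mul, mul_one]

lemma star_conj_mem_of_mem_normalizer {u b : A} (hu : u ∈ unitaryNormalizer B) (hb : b ∈ B) :
    star u * b * u ∈ B := by
  simpa using conj_mem_of_mem_normalizer (star_mem_normalizer hu) hb

lemma mul_mem_normalizer {u v : A} (hu : u ∈ unitaryNormalizer B)
    (hv : v ∈ unitaryNormalizer B) : u * v ∈ unitaryNormalizer B := by
  refine ⟨mul_mem hu.1 hv.1, ?_⟩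
  nth_rewrite 2 [← hu.2]
  nth_rewrite 2 [← hv.2]
  rw [Set.image_image]
  refine Set.image_congr fun b _ => ?_
  simp [mul_assoc]

lemma one_mem_normalizer : (1 : A) ∈ unitaryNormalizer B :=
  ⟨one_mem _, by simp⟩

/-- Since `u` normalizes `B`, the space `B u` is a `B`-bimodule, so orbits stay inside it. -/
lemma cone_apply_mul_star_mem {u : A} (hu : u ∈ unitaryNormalizer B) {T : A →ₗ[ℂ] A}
    (hT : T ∈ cone B) {x : A} (hx : x * star u ∈ B) : T x * star u ∈ B := by
  have hu1 := (Unitary.mem_iff.1 hu.1).1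
  refine AddSubmonoid.closure_induction (motive := fun T _ => T x * star u ∈ B) ?_ ?_ ?_ hT
  · rintro _ ⟨b, hb, rfl⟩
    have : conj b x * star u = b * (x * star u) * (u * star b * star u) := by
      rw [conj_apply]
      calc b * x * star b * star u = b * x * 1 * star b * star u := by rw [mul_one]
        _ = b * (x * star u) * (u * star b * star u) := by
          rw [← hu1]; simp only [mul_assoc]
    rw [this]
    exact mul_mem (mul_mem hb hx) (conj_mem_of_mem_normalizer hu (star_mem hb))
  · simp [zero_mem]
  · intro S T _ _ hS hT
    rw [LinearMap.add_apply, add_mul]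
    exact add_mem hS hT

variable [PartialOrder A] [StarOrderedRing A]

/-- The positive part `f` of `h - κ` detects whether `h ≤ κ`, and `f * h * f` exceeds
`κ * f ^ 2` by `f ^ 3`. -/
lemma exists_cutoff (hBc : IsClosed (B : Set A)) {h : A} (hhB : h ∈ B) (hh : IsSelfAdjoint h)
    (κ : ℝ) : ∃ f ∈ B, 0 ≤ f ∧ f * h * f - κ • (f * f) = f * f * f ∧
      (f = 0 → h ≤ algebraMap ℝ A κ) := by
  have : IsClosed (B : Set A) := hBc
  set k := h - algebraMap ℝ A κ with hk
  have hks : IsSelfAdjoint k := hh.sub (IsSelfAdjoint.algebraMap A (.all κ))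
  have hkB : k ∈ B := by
    rw [hk, algebraMap_real_eq_smul]
    exact sub_mem hhB (B.smul_mem (one_mem B) _)
  refine ⟨k⁺, ?_, CFC.posPart_nonneg k, ?_, fun h0 => ?_⟩
  · rw [CFC.posPart_def]
    exact cfcₙ_mem _ hkB
  · have h1 : k⁺ * k * k⁺ = k⁺ * k⁺ * k⁺ := by
      nth_rewrite 2 [← CFC.posPart_sub_negPart k hks]
      rw [mul_sub, CFC.posPart_mul_negPart, sub_zero]
    rw [← h1, eq_comm, ← sub_eq_zero, hk, Algebra.algebraMap_eq_smul_one]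
    simp only [mul_sub, sub_mul, mul_smul_comm, smul_mul_assoc, mul_one]
    abel
  · have := CFC.le_posPart hks
    rw [h0] at this
    exact sub_nonpos.1 this

/-- In the orbit of an element of `B u` under the elementary unital completely positive maps,
elements of almost minimal norm are close to each other. -/
lemma norm_sub_sq_le (hBc : IsClosed (B : Set A)) (hB : IsSimpleCStar B) {u : A}
    (hu : u ∈ unitaryNormalizer B) {y : A} (hy : y * star u ∈ B) {d r : ℝ}
    (hd0 : 0 < d) (hd : ∀ T ∈ ucp B, d ≤ ‖T y‖) {S T : A →ₗ[ℂ] A} (hS : S ∈ ucp B)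
    (hT : T ∈ ucp B) (hSr : ‖S y‖ ≤ r) (hTr : ‖T y‖ ≤ r) :
    ‖S y - T y‖ ^ 2 ≤ 4 * (r ^ 2 - d ^ 2) := by
  set s := S y with hs
  set t := T y with ht
  have hu1 := (Unitary.mem_iff.1 hu.1).1
  have hzu : (s - t) * star u ∈ B := by
    rw [sub_mul]
    exact sub_mem (cone_apply_mul_star_mem hu hS.1 hy) (cone_apply_mul_star_mem hu hT.1 hy)
  set h := (s - t) * star (s - t) with hh
  have hhB : h ∈ B := by
    have : h = ((s - t) * star u) * star ((s - t) * star u) := by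
      calc h = (s - t) * 1 * star (s - t) := by rw [mul_one]
        _ = _ := by rw [← hu1, star_mul, star_star]; simp only [mul_assoc]
    rw [this]
    exact mul_mem hzu (star_mem hzu)
  -- If `h ≤ κ` failed, compressing to the part of `h` above `κ` would give a map `R` in `ucp B`
  -- with `R h ≥ κ`. The parallelogram identity and the Schwarz inequality bound `‖R (s + t)‖ ^ 2`
  -- by `4 * r ^ 2 - κ < 4 * d ^ 2`, although half of `R (s + t)` lies in the orbit of `y`.
  refine le_of_forall_gt_imp_ge_of_dense fun κ hκ => ?_
  have hdr : d ≤ r := (hd S hS).trans hSr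
  refine norm_sq_le_of_mul_star_le (by nlinarith) ?_
  obtain ⟨f, hfB, hf0, hff, hfz⟩ := exists_cutoff hBc hhB (.mul_star_self _) κ
  refine hfz ?_
  by_contra hf
  have hfs : star f = f := hf0.isSelfAdjoint
  have hcube : 0 ≤ f * f * f := by
    simpa [hfs] using star_right_conjugate_nonneg hf0 f
  have hf2 : f * f ≠ 0 := by
    intro h0
    have : star f * f = 0 := by rw [hfs, h0]
    exact hf (CStarRing.star_mul_self_eq_zero_iff f |>.1 this)
  obtain ⟨P, hP, hP1⟩ := exists_cone_apply_eq_one hBc hB (mul_mem hfB hfB) hf2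
    (by simpa [hfs] using mul_star_self_nonneg f)
  have hR : P ∘ₗ conj f ∈ ucp B :=
    ⟨comp_conj_mem_cone hP hfB, by simp [conj_apply, hfs, hP1]⟩
  set R := P ∘ₗ conj f with hRdef
  have hRh : R h = κ • 1 + P (f * f * f) := by
    rw [← hff, hRdef, LinearMap.comp_apply, conj_apply, hfs, map_sub, LinearMap.map_smul_of_tower,
      hP1]
    abel
  have hbound : ∀ x : A, ‖x‖ ≤ r → R (x * star x) ≤ algebraMap ℝ A (r ^ 2) := by
    intro x hx
    have h1 : x * star x ≤ algebraMap ℝ A (r ^ 2) :=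
      CStarAlgebra.mul_star_le_algebraMap_norm_sq.trans
        (algebraMap_mono A (pow_le_pow_left₀ (norm_nonneg x) hx 2))
    refine (cone_apply_mono hR.1 h1).trans_eq ?_
    rw [map_algebraMap_real, hR.2, algebraMap_real_eq_smul]
  have hpar : (s + t) * star (s + t) + h = (s * star s + s * star s) +
      (t * star t + t * star t) := by
    rw [hh, star_add, star_sub]
    noncomm_ring
  have hsum : R (s + t) * star (R (s + t)) + κ • 1 ≤ algebraMap ℝ A (4 * r ^ 2) := by
    calc R (s + t) * star (R (s + t)) + κ • 1
        ≤ R ((s + t) * star (s + t)) + R h := by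
          refine add_le_add (ucp_schwarz hR _) ?_
          rw [hRh]
          exact le_add_of_nonneg_right (cone_apply_nonneg hP hcube)
      _ = R (s * star s) + R (s * star s) + (R (t * star t) + R (t * star t)) := by
          rw [← map_add, hpar, map_add, map_add, map_add]
      _ ≤ algebraMap ℝ A (r ^ 2) + algebraMap ℝ A (r ^ 2) +
          (algebraMap ℝ A (r ^ 2) + algebraMap ℝ A (r ^ 2)) :=
          add_le_add (add_le_add (hbound s hSr) (hbound s hSr))
            (add_le_add (hbound t hTr) (hbound t hTr))
      _ = algebraMap ℝ A (4 * r ^ 2) := by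
          rw [← map_add, ← map_add]
          congr 1
          ring
  have hle : R (s + t) * star (R (s + t)) ≤ algebraMap ℝ A (max (4 * r ^ 2 - κ) 0) := by
    refine le_trans ?_ (algebraMap_mono A (le_max_left _ _))
    rw [map_sub, le_sub_iff_add_le, Algebra.algebraMap_eq_smul_one κ]
    exact hsum
  have h1 := norm_sq_le_of_mul_star_le (le_max_right _ _) hle
  have h2 : 2 * d ≤ ‖R (s + t)‖ := by
    have h3 := hd _ (comp_mem_ucp hR (half_add_mem_ucp hS hT))
    have h4 : (R ∘ₗ ((2⁻¹ : ℂ) • (S + T))) y = (2⁻¹ : ℂ) • R (s + t) := by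
      simp [hs, ht]
    rw [h4, norm_smul] at h3
    norm_num at h3
    rw [map_add]
    linarith
  have h5 : (2 * d) ^ 2 ≤ max (4 * r ^ 2 - κ) 0 :=
    (pow_le_pow_left₀ (by linarith) h2 2).trans h1
  rcases le_max_iff.1 h5 with h6 | h6
  · linarith
  · nlinarith [pow_pos hd0 2]

/-- If a normalizing unitary `u` does not lie in `B`, the elements of `B u` can be averaged to
zero: otherwise their orbit would have a nonzero element of minimal norm, which is unique and
hence commutes with `B`. -/
lemma exists_ucp_norm_lt (hBc : IsClosed (B : Set A)) (hB : IsSimpleCStar B)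
    (hirr : IsIrreducible B) {u : A} (hu : u ∈ unitaryNormalizer B) (huB : u ∉ B) {y : A}
    (hy : y * star u ∈ B) {ε : ℝ} (hε : 0 < ε) : ∃ T ∈ ucp B, ‖T y‖ < ε := by
  by_contra! hcon
  set N : Set ℝ := (fun T : A →ₗ[ℂ] A => ‖T y‖) '' ucp B with hN
  have hNne : N.Nonempty := ⟨_, _, id_mem_ucp, rfl⟩
  have hNb : BddBelow N := ⟨ε, by rintro _ ⟨T, hT, rfl⟩; exact hcon T hT⟩
  set d := sInf N with hd
  have hεd : ε ≤ d := le_csInf hNne (by rintro _ ⟨T, hT, rfl⟩; exact hcon T hT)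
  have hd0 : 0 < d := hε.trans_le hεd
  have hdT : ∀ T ∈ ucp B, d ≤ ‖T y‖ := fun T hT => csInf_le hNb ⟨T, hT, rfl⟩
  obtain ⟨a, -, ha, haN⟩ := exists_seq_tendsto_sInf hNne hNb
  choose T hT hTa using haN
  simp only at hTa
  have hest : ∀ S ∈ ucp B, ∀ S' ∈ ucp B, ∀ r, ‖S y‖ ≤ r → ‖S' y‖ ≤ r →
      ‖S y - S' y‖ ^ 2 ≤ 4 * (r ^ 2 - d ^ 2) := fun S hS S' hS' r h h' =>
    norm_sub_sq_le hBc hB hu hy hd0 hdT hS hS' h h'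
  have hsmall : ∀ η > 0, ∃ n0, ∀ n ≥ n0, ∀ S ∈ ucp B, ‖S y‖ ≤ a n →
      ∀ S' ∈ ucp B, ∀ m ≥ n0, ‖S' y‖ ≤ a m → ‖S y - S' y‖ < η := by
    intro η hη
    have hlim : Filter.Tendsto (fun r : ℝ => 4 * (r ^ 2 - d ^ 2)) (nhds d) (nhds 0) := by
      have : Continuous fun r : ℝ => 4 * (r ^ 2 - d ^ 2) := by fun_prop
      simpa using this.tendsto d
    obtain ⟨δ, hδ, hδη⟩ := Metric.tendsto_nhds_nhds.1 hlim (η ^ 2) (by positivity)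
    obtain ⟨n0, hn0⟩ := Metric.tendsto_atTop.1 ha (δ / 2) (by positivity)
    have hbd : ∀ n ≥ n0, a n ≤ d + δ / 2 := by
      intro n hn
      have := hn0 n hn
      rw [Real.dist_eq] at this
      linarith [(abs_lt.1 this).2]
    refine ⟨n0, fun n hn S hS hSn S' hS' m hm hSm => ?_⟩
    have h1 := hest S hS S' hS' (d + δ / 2) (hSn.trans (hbd n hn)) (hSm.trans (hbd m hm))
    have h2 := @hδη (d + δ / 2) (by rw [Real.dist_eq, add_sub_cancel_left, abs_of_pos] <;> linarith)
    rw [Real.dist_eq, sub_zero] at h2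
    exact lt_of_pow_lt_pow_left₀ 2 hη.le (h1.trans_lt ((le_abs_self _).trans_lt h2))
  have hcau : CauchySeq fun n => T n y := by
    refine Metric.cauchySeq_iff.2 fun η hη => ?_
    obtain ⟨n0, h⟩ := hsmall η hη
    refine ⟨n0, fun m hm n hn => ?_⟩
    rw [dist_eq_norm]
    exact h m hm _ (hT m) (hTa m).le _ (hT n) n hn (hTa n).le
  obtain ⟨x, hx⟩ := cauchySeq_tendsto_of_complete hcau
  have hxn : ‖x‖ = d := tendsto_nhds_unique hx.norm (by simpa only [hTa] using ha)
  have hxu : x * star u ∈ B :=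
    hBc.mem_of_tendsto (hx.mul_const (star u))
      (Filter.Eventually.of_forall fun n => cone_apply_mul_star_mem hu (hT n).1 hy)
  have hcomm : ∀ v ∈ unitary A, v ∈ B → v * x = x * v := by
    intro v hv hvB
    -- The maps `conj v ∘ₗ T n` are also almost minimizing, so their values at `y` approach those of
    -- `T n`.
    have hconj : conj v x = x := by
      have h1 : Filter.Tendsto (fun n => conj v (T n y) - T n y) Filter.atTop
          (nhds (conj v x - x)) := by
        simp only [conj_apply]
        exact ((hx.const_mul v).mul_const (star v)).sub hx
      have h2 : Filter.Tendsto (fun n => conj v (T n y) - T n y) Filter.atTop (nhds 0) := by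
        refine Metric.tendsto_atTop.2 fun η hη => ?_
        obtain ⟨n0, h⟩ := hsmall η hη
        refine ⟨n0, fun n hn => ?_⟩
        rw [dist_eq_norm, sub_zero]
        exact h n hn (conj v ∘ₗ T n) (comp_mem_ucp (conj_mem_ucp hv hvB) (hT n))
          ((ucp_norm_le (conj_mem_ucp hv hvB) _).trans (hTa n).le) _ (hT n) n hn (hTa n).le
      exact sub_eq_zero.1 (tendsto_nhds_unique h1 h2)
    rw [conj_apply] at hconj
    calc v * x = v * x * (star v * v) := by rw [(Unitary.mem_iff.1 hv).1, mul_one]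
      _ = v * x * star v * v := by simp only [mul_assoc]
      _ = x * v := by rw [hconj]
  have hcommB : ∀ b ∈ B, b * x = x * b := by
    have : IsClosed (B : Set A) := hBc
    intro b hb
    have hspan : (⟨b, hb⟩ : B) ∈ Submodule.span ℂ (unitary B : Set B) := by
      rw [CStarAlgebra.span_unitary]; trivial
    refine Submodule.span_induction (p := fun (b : B) _ => (b : A) * x = x * b) ?_ ?_ ?_ ?_ hspan
    · intro v hv
      have hv' := Unitary.mem_iff.1 hv
      exact hcomm v (Unitary.mem_iff.2 ⟨congrArg Subtype.val hv'.1, congrArg Subtype.val hv'.2⟩)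
        v.2
    · simp
    · intro b c _ _ hb hc
      simp [add_mul, mul_add, hb, hc]
    · intro c b _ hb
      simp [hb]
  obtain ⟨c, hc⟩ : ∃ c : ℂ, algebraMap ℂ A c = x := by
    have : x ∈ StarSubalgebra.centralizer ℂ (B : Set A) := by
      rw [StarSubalgebra.mem_centralizer_iff]
      exact fun b hb => ⟨hcommB b hb, hcommB (star b) (star_mem hb)⟩
    rw [hirr, StarSubalgebra.mem_bot] at this
    exact this
  have hx0 : x ≠ 0 := by
    rintro rfl
    rw [norm_zero] at hxn
    exact hd0.ne hxn
  have hc0 : c ≠ 0 := by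
    rintro rfl
    exact hx0 (by rw [← hc, map_zero])
  refine huB ?_
  have h1 : star u ∈ B := by
    have : star u = c⁻¹ • (x * star u) := by
      rw [← hc, ← Algebra.smul_def, smul_smul, inv_mul_cancel₀ hc0, one_smul]
    rw [this]
    exact B.smul_mem hxu _
  simpa using star_mem h1

end Outer

/-! ### Conditional expectations: coefficients, averaging and faithfulness -/

section Expectation

variable {A : Type*} [CStarAlgebra A]

/-- Reduces density of the generated *-algebra to density of a linear span, so that closed linear
conditions can be checked on unitaries. -/
lemma adjoin_eq_span_of_submonoid {S : Set A} (h1 : 1 ∈ S) (hmul : ∀ u ∈ S, ∀ v ∈ S, u * v ∈ S)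
    (hstar : ∀ u ∈ S, star u ∈ S) :
    (StarAlgebra.adjoin ℂ S : Set A) = Submodule.span ℂ S := by
  have h2 : S ∪ star S = S := Set.union_eq_left.2 fun u hu => by simpa using hstar _ hu
  have h3 : (Submonoid.closure S : Set A) = S := by
    let M : Submonoid A := ⟨⟨S, fun {a b} ha hb => hmul a ha b hb⟩, h1⟩
    exact congrArg (fun M : Submonoid A => (M : Set A)) (Submonoid.closure_eq M)
  have h4 : Subalgebra.toSubmodule (StarAlgebra.adjoin ℂ S).toSubalgebra =
      Submodule.span ℂ S := by
    rw [StarAlgebra.adjoin_toSubalgebra, h2, Algebra.adjoin_eq_span, h3]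
  exact congrArg (fun M : Submodule ℂ A => (M : Set A)) h4

/-- A conditional expectation onto `B`, viewed as a positive self-map of the ambient algebra. -/
structure IsCondExp [PartialOrder A] (B : StarSubalgebra ℂ A) (E : A →ₗ[ℂ] A) : Prop where
  mem : ∀ a, E a ∈ B
  fix : ∀ b ∈ B, E b = b
  left : ∀ b ∈ B, ∀ a, E (b * a) = b * E a
  right : ∀ b ∈ B, ∀ a, E (a * b) = E a * b
  nonneg : ∀ a, 0 ≤ a → 0 ≤ E a

variable {B : StarSubalgebra ℂ A}

lemma IsRegular.closure_span (hreg : IsRegular B) (x : A) :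
    x ∈ closure (Submodule.span ℂ (unitaryNormalizer B) : Set A) := by
  rw [← adjoin_eq_span_of_submonoid one_mem_normalizer (fun u hu v hv => mul_mem_normalizer hu hv)
    fun u hu => star_mem_normalizer hu, ← StarSubalgebra.topologicalClosure_coe, hreg]
  trivial

/-- A closed condition that holds for the normalizing unitaries holds everywhere. -/
lemma IsRegular.eq_zero_of_normalizer (hreg : IsRegular B) {F : A →ₗ[ℂ] A} (hF : Continuous F)
    (h : ∀ u ∈ unitaryNormalizer B, F u = 0) (x : A) : F x = 0 := by
  have hcl : IsClosed {x | F x = 0} := isClosed_eq hF continuous_const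
  refine closure_minimal (fun z hz => ?_) hcl (hreg.closure_span x)
  exact (Submodule.span_le (p := LinearMap.ker F)).2 h hz

section Order

variable [PartialOrder A] {E : A →ₗ[ℂ] A}

lemma IsCondExp.map_one (hE : IsCondExp B E) : E 1 = 1 := hE.fix 1 (one_mem B)

/-- A conditional expectation onto an irreducible subalgebra vanishes on the normalizing
unitaries outside the subalgebra. -/
lemma IsCondExp.map_normalizer (hE : IsCondExp B E) (hirr : IsIrreducible B) {u : A}
    (hu : u ∈ unitaryNormalizer B) (huB : u ∉ B) : E u = 0 := by
  have hu1 := Unitary.mem_iff.1 hu.1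
  have hcomm : ∀ b ∈ B, b * (star u * E u) = (star u * E u) * b := by
    intro b hb
    -- Both sides equal `E (u * b)`, as `u * b = (u * b * star u) * u`.
    have h1 : E u * b = (u * b * star u) * E u := by
      rw [← hE.right b hb, ← hE.left _ (conj_mem_of_mem_normalizer hu hb), mul_assoc, hu1.1,
        mul_one]
    calc b * (star u * E u) = (star u * u) * b * (star u * E u) := by rw [hu1.1, one_mul]
      _ = star u * ((u * b * star u) * E u) := by simp only [mul_assoc]
      _ = _ := by rw [← h1, mul_assoc]
  obtain ⟨c, hc⟩ : ∃ c : ℂ, algebraMap ℂ A c = star u * E u := by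
    have : star u * E u ∈ StarSubalgebra.centralizer ℂ (B : Set A) := by
      rw [StarSubalgebra.mem_centralizer_iff]
      exact fun b hb => ⟨hcomm b hb, hcomm (star b) (star_mem hb)⟩
    rw [hirr, StarSubalgebra.mem_bot] at this
    exact this
  have hEu : E u = c • u := by
    calc E u = u * (star u * E u) := by rw [← mul_assoc, hu1.2, one_mul]
      _ = c • u := by rw [← hc, ← Algebra.commutes, ← Algebra.smul_def]
  by_cases hc0 : c = 0
  · rw [hEu, hc0, zero_smul]
  · refine absurd ?_ huB
    have : u = c⁻¹ • E u := by rw [hEu, smul_smul, inv_mul_cancel₀ hc0, one_smul]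
    rw [this]
    exact B.smul_mem (hE.mem u) _

lemma IsCondExp.map_algebraMap (hE : IsCondExp B E) (r : ℝ) :
    E (algebraMap ℝ A r) = algebraMap ℝ A r := by
  rw [map_algebraMap_real, hE.map_one, algebraMap_real_eq_smul]

end Order

variable [PartialOrder A] [StarOrderedRing A]

lemma IsConditionalExpectation.isCondExp {E : A →ₗ[ℂ] B} (hE : IsConditionalExpectation B E) :
    IsCondExp B (B.subtype.toAlgHom.toLinearMap ∘ₗ E) where
  mem a := (E a).2
  fix b hb := congrArg Subtype.val (hE.map_coe ⟨b, hb⟩)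
  left b hb a := congrArg Subtype.val (hE.map_mul_left ⟨b, hb⟩ a)
  right b hb a := congrArg Subtype.val (hE.map_mul_right a ⟨b, hb⟩)
  nonneg a ha := by
    obtain ⟨s, rfl⟩ := CStarAlgebra.nonneg_iff_eq_star_mul_self.1 ha
    obtain ⟨c, hc⟩ := hE.map_nonneg s
    have : (B.subtype.toAlgHom.toLinearMap ∘ₗ E) (star s * s) = star (c : A) * (c : A) :=
      congrArg Subtype.val hc
    rw [this]
    exact star_mul_self_nonneg _

namespace IsCondExp

variable {E : A →ₗ[ℂ] A}

lemma mono (hE : IsCondExp B E) {a b : A} (h : a ≤ b) : E a ≤ E b := by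
  rw [← sub_nonneg, ← map_sub]
  exact hE.nonneg _ (sub_nonneg.2 h)

lemma map_star (hE : IsCondExp B E) (a : A) : E (star a) = star (E a) := by
  have ha : a ∈ Submodule.span ℂ {a : A | 0 ≤ a} := by
    rw [CStarAlgebra.span_nonneg]; trivial
  refine Submodule.span_induction (p := fun a _ => E (star a) = star (E a)) ?_ ?_ ?_ ?_ ha
  · intro a ha
    rw [(IsSelfAdjoint.of_nonneg ha).star_eq, (IsSelfAdjoint.of_nonneg (hE.nonneg a ha)).star_eq]
  · simp
  · intro a b _ _ ha hb
    simp [ha, hb]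
  · intro c a _ ha
    simp [ha]

/-- The difference of the two sides is `E` applied to `star (a - E a) * (a - E a)`. -/
lemma star_mul_self_le (hE : IsCondExp B E) (a : A) : star (E a) * E a ≤ E (star a * a) := by
  have h := hE.nonneg _ (star_mul_self_nonneg (a - E a))
  rw [star_sub, sub_mul, mul_sub, mul_sub, map_sub, map_sub, map_sub,
    hE.left _ (star_mem (hE.mem a)), hE.left _ (star_mem (hE.mem a)), hE.right _ (hE.mem a),
    hE.map_star, hE.fix _ (hE.mem a)] at h
  rw [← sub_nonneg]
  simpa using h

lemma norm_le (hE : IsCondExp B E) (a : A) : ‖E a‖ ≤ ‖a‖ := by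
  refine le_of_sq_le_sq ?_ (norm_nonneg a)
  rw [← norm_star (E a)]
  refine norm_sq_le_of_mul_star_le (by positivity) ?_
  rw [star_star]
  refine (hE.star_mul_self_le a).trans ?_
  refine (hE.mono CStarAlgebra.star_mul_le_algebraMap_norm_sq).trans_eq ?_
  rw [hE.map_algebraMap]

lemma continuous (hE : IsCondExp B E) : Continuous E :=
  AddMonoidHomClass.continuous_of_bound E 1 fun a => by simpa using hE.norm_le a

/-- `E (a* x* x a) ≤ ‖x‖² E (a* a)`. -/
lemma star_mul_mul_le (hE : IsCondExp B E) (x a : A) :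
    E (star (x * a) * (x * a)) ≤ E (star a * (algebraMap ℝ A (‖x‖ ^ 2)) * a) := by
  refine hE.mono ?_
  have := star_left_conjugate_le_conjugate
    (CStarAlgebra.star_mul_le_algebraMap_norm_sq (a := x)) a
  simpa [mul_assoc] using this

lemma map_mul_eq_zero (hE : IsCondExp B E) {a : A} (ha : E (star a * a) = 0) (x : A) :
    E (x * a) = 0 := by
  have h1 := (hE.star_mul_self_le (x * a)).trans (hE.star_mul_mul_le x a)
  rw [algebraMap_real_eq_smul, mul_smul_comm, mul_one, smul_mul_assoc, map_smul, ha,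
    smul_zero] at h1
  have h2 : star (E (x * a)) * E (x * a) = 0 := le_antisymm h1 (star_mul_self_nonneg _)
  exact (CStarRing.star_mul_self_eq_zero_iff _).1 h2

end IsCondExp

/-- The difference `x - E x` can be averaged to zero. -/
lemma exists_ucp_norm_sub_lt (hBc : IsClosed (B : Set A)) (hB : IsSimpleCStar B)
    (hreg : IsRegular B) (hirr : IsIrreducible B) {E : A →ₗ[ℂ] A} (hE : IsCondExp B E) (x : A)
    {ε : ℝ} (hε : 0 < ε) : ∃ T ∈ ucp B, ‖T (x - E x)‖ < ε := by
  -- The preliminary map `S` lets sums be handled one term after another: the second term is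
  -- averaged after the map chosen for the first, and contractivity keeps the first small.
  have hspan : ∀ z ∈ Submodule.span ℂ (unitaryNormalizer B), ∀ S ∈ ucp B, ∀ ε : ℝ, 0 < ε →
      ∃ T ∈ ucp B, ‖T (S (z - E z))‖ < ε := by
    intro z hz
    refine Submodule.span_induction (p := fun z _ => ∀ S ∈ ucp B, ∀ ε : ℝ, 0 < ε →
      ∃ T ∈ ucp B, ‖T (S (z - E z))‖ < ε) ?_ ?_ ?_ ?_ hz
    · intro u hu S hS ε hε
      by_cases huB : u ∈ B
      · exact ⟨_, id_mem_ucp, by simpa [hE.fix u huB] using hε⟩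
      · rw [hE.map_normalizer hirr hu huB, sub_zero]
        refine exists_ucp_norm_lt hBc hB hirr hu huB (cone_apply_mul_star_mem hu hS.1 ?_) hε
        rw [(Unitary.mem_iff.1 hu.1).2]
        exact one_mem B
    · intro S _ ε hε
      exact ⟨_, id_mem_ucp, by simpa using hε⟩
    · intro y z _ _ hy hz S hS ε hε
      obtain ⟨T, hT, h1⟩ := hy S hS (ε / 2) (half_pos hε)
      obtain ⟨R, hR, h2⟩ := hz (T ∘ₗ S) (comp_mem_ucp hT hS) (ε / 2) (half_pos hε)
      refine ⟨R ∘ₗ T, comp_mem_ucp hR hT, ?_⟩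
      have : (R ∘ₗ T) (S (y + z - E (y + z))) =
          R (T (S (y - E y))) + R ((T ∘ₗ S) (z - E z)) := by
        simp only [LinearMap.comp_apply, map_add, map_sub]
        abel
      rw [this]
      calc _ ≤ ‖R (T (S (y - E y)))‖ + ‖R ((T ∘ₗ S) (z - E z))‖ := norm_add_le _ _
        _ < ε / 2 + ε / 2 := add_lt_add ((ucp_norm_le hR _).trans_lt h1) h2
        _ = ε := add_halves ε
    · intro c z _ hz S hS ε hε
      obtain ⟨T, hT, h⟩ := hz S hS (ε / (‖c‖ + 1)) (by positivity)
      refine ⟨T, hT, ?_⟩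
      have : T (S (c • z - E (c • z))) = c • T (S (z - E z)) := by
        simp only [map_smul, map_sub, smul_sub]
      rw [this, norm_smul]
      rw [lt_div_iff₀ (by positivity)] at h
      nlinarith [norm_nonneg (T (S (z - E z)))]
  obtain ⟨z, hz, hxz⟩ := Metric.mem_closure_iff.1 (hreg.closure_span x) (ε / 4) (by positivity)
  rw [dist_eq_norm] at hxz
  obtain ⟨T, hT, h⟩ := hspan z hz LinearMap.id id_mem_ucp (ε / 2) (half_pos hε)
  refine ⟨T, hT, ?_⟩
  have : T (x - E x) = T ((x - z) - E (x - z)) + T ((LinearMap.id : A →ₗ[ℂ] A) (z - E z)) := by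
    rw [LinearMap.id_apply, ← map_add, map_sub E]
    congr 1
    abel
  rw [this]
  calc _ ≤ ‖T ((x - z) - E (x - z))‖ + ‖T ((LinearMap.id : A →ₗ[ℂ] A) (z - E z))‖ := norm_add_le _ _
    _ < (ε / 4 + ε / 4) + ε / 2 := by
      refine add_lt_add ((ucp_norm_le hT _).trans_lt ?_) h
      exact (norm_sub_le _ _).trans_lt (add_lt_add hxz ((hE.norm_le _).trans_lt hxz))
    _ = ε := by ring

/-- A normalizing unitary in the support of an element of an intermediate algebra lies in the
intermediate algebra. -/
lemma mem_of_map_mul_star_ne_zero (hBc : IsClosed (B : Set A)) (hB : IsSimpleCStar B)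
    (hreg : IsRegular B) (hirr : IsIrreducible B) {E : A →ₗ[ℂ] A} (hE : IsCondExp B E)
    {C : StarSubalgebra ℂ A} (hCc : IsClosed (C : Set A)) (hBC : B ≤ C) {x u : A} (hx : x ∈ C)
    (hu : u ∈ unitaryNormalizer B) (h : E (x * star u) ≠ 0) : u ∈ C := by
  have hu1 := (Unitary.mem_iff.1 hu.1).1
  have hmod : ∀ p ∈ B, ∀ q ∈ B, ∀ y, y * u ∈ C → p * y * q * u ∈ C := by
    intro p hp q hq y hy
    have : p * y * q * u = p * (y * u) * (star u * q * u) := by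
      calc p * y * q * u = p * y * 1 * q * u := by rw [mul_one]
        _ = p * y * (u * star u) * q * u := by rw [(Unitary.mem_iff.1 hu.1).2]
        _ = _ := by simp only [mul_assoc]
    rw [this]
    exact mul_mem (mul_mem (hBC hp) hy) (hBC (star_conj_mem_of_mem_normalizer hu hq))
  have hcone : ∀ T ∈ cone B, ∀ y, y * u ∈ C → T y * u ∈ C := by
    intro T hT y hy
    refine AddSubmonoid.closure_induction (motive := fun T _ => T y * u ∈ C) ?_ ?_ ?_ hT
    · rintro _ ⟨b, hb, rfl⟩
      rw [conj_apply]
      exact hmod b hb _ (star_mem hb) y hy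
    · simp [zero_mem]
    · intro S T _ _ hS hT
      rw [LinearMap.add_apply, add_mul]
      exact add_mem hS hT
  -- The unit is a sum of terms `p * E (x * star u) * q`, up to sign; by the bimodule property each
  -- lifts to `p * (x * star u) * q`.
  obtain ⟨y, hyC, hy1⟩ : ∃ y, y * u ∈ C ∧ E y = 1 := by
    refine AddSubgroup.closure_induction (p := fun t _ => ∃ y, y * u ∈ C ∧ E y = t)
      ?_ ?_ ?_ ?_ (exists_mem_ideal hBc hB (hE.mem (x * star u)) h)
    · rintro _ ⟨p, hp, q, hq, rfl⟩
      refine ⟨p * (x * star u) * q, hmod p hp q hq _ ?_, by rw [hE.right q hq, hE.left p hp]⟩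
      rw [mul_assoc, hu1, mul_one]
      exact hx
    · exact ⟨0, by simp [zero_mem], map_zero E⟩
    · rintro s t _ _ ⟨y, hy, rfl⟩ ⟨z, hz, rfl⟩
      exact ⟨y + z, by rw [add_mul]; exact add_mem hy hz, map_add E _ _⟩
    · rintro s _ ⟨y, hy, rfl⟩
      exact ⟨-y, by rw [neg_mul]; exact neg_mem hy, map_neg E _⟩
  rw [← SetLike.mem_coe, ← hCc.closure_eq]
  refine Metric.mem_closure_iff.2 fun ε hε => ?_
  obtain ⟨T, hT, hTε⟩ := exists_ucp_norm_sub_lt hBc hB hreg hirr hE y hε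
  refine ⟨T y * u, hcone T hT.1 y hyC, ?_⟩
  rw [hy1, map_sub, hT.2] at hTε
  rw [dist_comm, dist_eq_norm]
  calc ‖T y * u - u‖ = ‖(T y - 1) * u‖ := by rw [sub_mul, one_mul]
    _ = ‖T y - 1‖ := CStarRing.norm_mul_mem_unitary _ hu.1
    _ < ε := hTε

/-- A conditional expectation of a simple C*-algebra onto a regular irreducible subalgebra is
faithful. -/
lemma IsCondExp.faithful (hA : IsSimpleCStar A) (hreg : IsRegular B) (hirr : IsIrreducible B)
    {E : A →ₗ[ℂ] A} (hE : IsCondExp B E) {a : A} (ha : E (star a * a) = 0) : a = 0 := by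
  -- It suffices to take `w = v` a normalizing unitary: then `star u * v * u` lies in `B` exactly
  -- when `v` does, and outside `B` both sides vanish.
  have hconj : ∀ u ∈ unitaryNormalizer B, ∀ w, E (star u * w * u) = star u * E w * u := by
    intro u hu w
    let F : A →ₗ[ℂ] A := E ∘ₗ conj (star u) - conj (star u) ∘ₗ E
    have hF : ∀ w, F w = E (star u * w * u) - star u * E w * u := fun w => by
      simp [F, conj_apply]
    have hFc : Continuous F := by
      have := hE.continuous
      simp only [funext hF]
      fun_prop
    refine sub_eq_zero.1 ((hF w).symm.trans (hreg.eq_zero_of_normalizer hFc (fun v hv => ?_) w))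
    rw [hF]
    have hsv : star u * v * u ∈ unitaryNormalizer B :=
      mul_mem_normalizer (mul_mem_normalizer (star_mem_normalizer hu) hv) hu
    by_cases hvB : v ∈ B
    · rw [hE.fix v hvB, hE.fix _ (star_conj_mem_of_mem_normalizer hu hvB), sub_self]
    · rw [hE.map_normalizer hirr hv hvB, hE.map_normalizer hirr hsv, mul_zero, zero_mul, sub_zero]
      intro h
      refine hvB ?_
      have hu1 := (Unitary.mem_iff.1 hu.1).2
      have h2 := conj_mem_of_mem_normalizer hu h
      have : u * (star u * v * u) * star u = v := by
        calc u * (star u * v * u) * star u = (u * star u) * v * (u * star u) := by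
              simp only [mul_assoc]
          _ = v := by rw [hu1, one_mul, mul_one]
      rwa [this] at h2
  have hEc := hE.continuous
  let I : TwoSidedIdeal A := TwoSidedIdeal.mk' {a | ∀ x y, E (x * a * y) = 0}
    (by simp) (fun {a b} ha hb x y => by rw [mul_add, add_mul, map_add, ha, hb, add_zero])
    (fun {a} ha x y => by rw [mul_neg, neg_mul, map_neg, ha, neg_zero])
    (fun {a b} hb x y => by rw [← mul_assoc x a b]; exact hb _ y)
    (fun {a b} ha x y => by
      rw [show x * (a * b) * y = x * a * (b * y) by simp only [mul_assoc]]; exact ha x _)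
  have hI : (I : Set A) = {a | ∀ x y, E (x * a * y) = 0} := TwoSidedIdeal.coe_mk' _ _ _ _ _ _
  have hIc : IsClosed (I : Set A) := by
    rw [hI]
    simp only [Set.ofPred_forall]
    exact isClosed_iInter fun x => isClosed_iInter fun y =>
      isClosed_eq (by fun_prop) continuous_const
  have haI : a ∈ I := by
    rw [← SetLike.mem_coe, hI]
    intro x y
    have hFc : Continuous (E ∘ₗ LinearMap.mulLeft ℂ (x * a)) :=
      hEc.comp (continuous_const_mul (x * a))
    refine hreg.eq_zero_of_normalizer hFc (fun u hu => ?_) y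
    -- Invariance of `E` under conjugation turns vanishing of `E` on left multiples of `a` into
    -- vanishing on two-sided multiples.
    have : x * a * u = star u * (u * x * a) * u := by
      calc x * a * u = (star u * u) * (x * a * u) := by rw [(Unitary.mem_iff.1 hu.1).1, one_mul]
        _ = _ := by simp only [mul_assoc]
    rw [LinearMap.comp_apply, LinearMap.mulLeft_apply, this, hconj u hu,
      hE.map_mul_eq_zero ha, mul_zero, zero_mul]
  rcases hA.2 I hIc with h | h
  · rw [h] at haI
    exact (TwoSidedIdeal.mem_bot A).1 haI
  · have h1 : (1 : A) ∈ (I : Set A) := by rw [h]; trivial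
    rw [hI] at h1
    have h2 := h1 1 1
    rw [mul_one, mul_one, hE.map_one] at h2
    rw [← mul_one a, h2, mul_zero]

end Expectation

/-! ### Intermediate algebras -/

section Intermediate

variable {A : Type*} [CStarAlgebra A]

lemma mem_span_of_mul_mem {S T U : Set A} (h : ∀ u ∈ S, ∀ v ∈ T, u * v ∈ U) {x y : A}
    (hx : x ∈ Submodule.span ℂ S) (hy : y ∈ Submodule.span ℂ T) :
    x * y ∈ Submodule.span ℂ U := by
  have h1 := Submodule.mul_mem_mul hx hy
  rw [Submodule.span_mul_span] at h1
  refine Submodule.span_mono ?_ h1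
  rintro _ ⟨u, hu, v, hv, rfl⟩
  exact h u hu v hv

variable {B C : StarSubalgebra ℂ A}

/-- Together with `notMem_mul`, this makes the span of `N \ C` a bimodule over the span of the group
`N ∩ C`. -/
lemma mul_notMem {u v : A} (hv : v ∈ unitaryNormalizer B ∩ C) (huC : u ∉ C) : u * v ∉ C := by
  intro h
  refine huC ?_
  have := mul_mem h (star_mem hv.2)
  rwa [mul_assoc, (Unitary.mem_iff.1 hv.1.1).2, mul_one] at this

lemma notMem_mul {u v : A} (hu : u ∈ unitaryNormalizer B ∩ C) (hvC : v ∉ C) : u * v ∉ C := by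
  intro h
  refine hvC ?_
  have := mul_mem (star_mem hu.2) h
  rwa [← mul_assoc, (Unitary.mem_iff.1 hu.1.1).1, one_mul] at this

lemma adjoin_inter_eq_span :
    (StarAlgebra.adjoin ℂ (unitaryNormalizer B ∩ C) : Set A) =
      Submodule.span ℂ (unitaryNormalizer B ∩ C) :=
  adjoin_eq_span_of_submonoid ⟨one_mem_normalizer, one_mem C⟩
    (fun _ hu _ hv => ⟨mul_mem_normalizer hu.1 hv.1, mul_mem hu.2 hv.2⟩)
    fun _ hu => ⟨star_mem_normalizer hu.1, star_mem hu.2⟩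

variable [PartialOrder A] [StarOrderedRing A]

/-- The projection of the span of the normalizing unitaries onto the span of those in `C` is
contractive. -/
lemma norm_le_norm_add (hA : IsSimpleCStar A) (hreg : IsRegular B) (hirr : IsIrreducible B)
    {E : A →ₗ[ℂ] A} (hE : IsCondExp B E) (hBC : B ≤ C) {y w : A}
    (hy : y ∈ Submodule.span ℂ (unitaryNormalizer B ∩ C))
    (hw : w ∈ Submodule.span ℂ (unitaryNormalizer B \ C)) : ‖y‖ ≤ ‖y + w‖ := by
  have hEw : ∀ w ∈ Submodule.span ℂ (unitaryNormalizer B \ C), E w = 0 := fun w hw =>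
    (Submodule.span_le (p := LinearMap.ker E)).2
      (fun u hu => hE.map_normalizer hirr hu.1 fun h => hu.2 (hBC h)) hw
  have hstar : ∀ p ∈ Submodule.span ℂ (unitaryNormalizer B ∩ C),
      star p ∈ Submodule.span ℂ (unitaryNormalizer B ∩ C) := by
    intro p hp
    rw [← SetLike.mem_coe, ← adjoin_inter_eq_span] at hp ⊢
    exact star_mem hp
  set κ := ‖y + w‖ ^ 2 with hκ
  set D := (StarAlgebra.adjoin ℂ (unitaryNormalizer B ∩ C)).topologicalClosure with hD
  have hDc : IsClosed (D : Set A) := StarSubalgebra.isClosed_topologicalClosure _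
  -- The cross terms between `y * b` and `w * b` lie in the span of `N \ C`, where `E` vanishes, and
  -- the `w` term is positive.
  have hspan : ∀ b ∈ Submodule.span ℂ (unitaryNormalizer B ∩ C),
      E (star b * (star y * y) * b) ≤ E (star b * algebraMap ℝ A κ * b) := by
    intro b hb
    refine le_trans ?_ (hE.star_mul_mul_le (y + w) b)
    have hp : y * b ∈ Submodule.span ℂ (unitaryNormalizer B ∩ C) :=
      mem_span_of_mul_mem (S := unitaryNormalizer B ∩ C) (T := unitaryNormalizer B ∩ C)
        (U := unitaryNormalizer B ∩ C)
        (fun u hu v hv => ⟨mul_mem_normalizer hu.1 hv.1, mul_mem hu.2 hv.2⟩) hy hb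
    have hq : w * b ∈ Submodule.span ℂ (unitaryNormalizer B \ C) :=
      mem_span_of_mul_mem (S := unitaryNormalizer B \ C) (T := unitaryNormalizer B ∩ C)
        (U := unitaryNormalizer B \ C)
        (fun u hu v hv => ⟨mul_mem_normalizer hu.1 hv.1, mul_notMem hv hu.2⟩) hw hb
    have hpq : E (star (y * b) * (w * b)) = 0 := hEw _ <|
      mem_span_of_mul_mem (S := unitaryNormalizer B ∩ C) (T := unitaryNormalizer B \ C)
        (U := unitaryNormalizer B \ C)
        (fun u hu v hv => ⟨mul_mem_normalizer hu.1 hv.1, notMem_mul hu hv.2⟩)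
        (hstar _ hp) hq
    have hqp : E (star (w * b) * (y * b)) = 0 := by
      rw [← star_star (y * b), ← star_mul, hE.map_star, hpq, star_zero]
    have hsum : E (star ((y + w) * b) * ((y + w) * b)) =
        E (star (y * b) * (y * b)) + E (star (w * b) * (w * b)) := by
      rw [add_mul, star_add, mul_add, add_mul, add_mul, map_add, map_add, map_add, hpq, hqp]
      abel
    rw [hsum, star_mul, show star b * (star y * y) * b = star b * star y * (y * b) by
      simp only [mul_assoc]]
    exact le_add_of_nonneg_right (hE.nonneg _ (star_mul_self_nonneg _))
  have hclos : ∀ b ∈ D, E (star b * (star y * y) * b) ≤ E (star b * algebraMap ℝ A κ * b) := by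
    have hEc := hE.continuous
    have hcl : IsClosed {b | 0 ≤ E (star b * algebraMap ℝ A κ * b) -
        E (star b * (star y * y) * b)} :=
      CStarAlgebra.isClosed_nonneg.preimage (by fun_prop)
    intro b hb
    rw [← SetLike.mem_coe, hD, StarSubalgebra.topologicalClosure_coe, adjoin_inter_eq_span] at hb
    exact sub_nonneg.1 (closure_minimal (fun b hb => sub_nonneg.2 (hspan b hb)) hcl hb)
  have hyD : y ∈ D := by
    rw [← SetLike.mem_coe, hD, StarSubalgebra.topologicalClosure_coe, adjoin_inter_eq_span]
    exact subset_closure hy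
  -- Testing the inequality at `b = f`, the positive part of `star y * y - κ`, gives `E (f * f * f)
  -- ≤ 0`, so `f = 0` by faithfulness. The cutoff needs a closed algebra, hence the passage to `D`.
  obtain ⟨f, hfD, hf0, hff, hfz⟩ := exists_cutoff hDc (mul_mem (star_mem hyD) hyD)
    (.star_mul_self y) κ
  have hfs : star f = f := hf0.isSelfAdjoint
  have hcube : 0 ≤ f * f * f := by
    simpa [hfs] using star_right_conjugate_nonneg hf0 f
  have hEf : E (f * f * f) = 0 := by
    refine le_antisymm ?_ (hE.nonneg _ hcube)
    have := hclos f hfD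
    rw [hfs, Algebra.algebraMap_eq_smul_one, mul_smul_comm, smul_mul_assoc, mul_one] at this
    rw [← hff, map_sub]
    exact sub_nonpos.2 this
  have hfff : f * f * f = 0 := by
    obtain ⟨s, hs⟩ := CStarAlgebra.nonneg_iff_eq_star_mul_self.1 hcube
    rw [hs] at hEf ⊢
    rw [hE.faithful hA hreg hirr hEf, mul_zero]
  have hf : f = 0 := by
    have h1 : star (f * f) * (f * f) = 0 := by
      rw [star_mul, hfs, ← mul_assoc, hfff, zero_mul]
    have h2 : star f * f = 0 := by
      rw [hfs]
      exact (CStarRing.star_mul_self_eq_zero_iff _).1 h1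
    exact (CStarRing.star_mul_self_eq_zero_iff _).1 h2
  refine le_of_sq_le_sq ?_ (norm_nonneg _)
  rw [← norm_star y]
  refine norm_sq_le_of_mul_star_le (by positivity) ?_
  rw [star_star]
  exact hfz hf

/-- An intermediate algebra is generated by the normalizing unitaries that it contains. -/
theorem le_topologicalClosure_adjoin (hBc : IsClosed (B : Set A)) (hA : IsSimpleCStar A)
    (hB : IsSimpleCStar B) (hreg : IsRegular B) (hirr : IsIrreducible B)
    {E : A →ₗ[ℂ] A} (hE : IsCondExp B E) (hCc : IsClosed (C : Set A)) (hBC : B ≤ C) :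
    C ≤ (StarAlgebra.adjoin ℂ (unitaryNormalizer B ∩ C)).topologicalClosure := by
  intro x hx
  have hEc := hE.continuous
  obtain ⟨z, hz, hzx⟩ := mem_closure_iff_seq_limit.1 (hreg.closure_span x)
  have hdec : ∀ n, ∃ y ∈ Submodule.span ℂ (unitaryNormalizer B ∩ C),
      ∃ w ∈ Submodule.span ℂ (unitaryNormalizer B \ C), y + w = z n := by
    intro n
    have h := hz n
    rw [SetLike.mem_coe, ← Set.inter_union_sdiff (unitaryNormalizer B) (C : Set A),
      Submodule.span_union] at h
    exact Submodule.mem_sup.1 h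
  choose y hy w hw hyw using hdec
  have hcau : CauchySeq y := by
    refine Metric.cauchySeq_iff.2 fun ε hε => ?_
    obtain ⟨n0, h⟩ := Metric.cauchySeq_iff.1 hzx.cauchySeq ε hε
    refine ⟨n0, fun m hm n hn => lt_of_le_of_lt ?_ (h m hm n hn)⟩
    rw [dist_eq_norm, dist_eq_norm, ← hyw, ← hyw, add_sub_add_comm]
    exact norm_le_norm_add hA hreg hirr hE hBC (sub_mem (hy m) (hy n)) (sub_mem (hw m) (hw n))
  obtain ⟨d, hd⟩ := cauchySeq_tendsto_of_complete hcau
  have hdcl : d ∈ (StarAlgebra.adjoin ℂ (unitaryNormalizer B ∩ C)).topologicalClosure := by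
    rw [← SetLike.mem_coe, StarSubalgebra.topologicalClosure_coe, adjoin_inter_eq_span]
    exact mem_closure_of_tendsto hd (Filter.Eventually.of_forall hy)
  have hdC : d ∈ C := by
    refine hCc.mem_of_tendsto hd (Filter.Eventually.of_forall fun n => ?_)
    exact (Submodule.span_le (p := Subalgebra.toSubmodule C.toSubalgebra)).2
      (fun u hu => hu.2) (hy n)
  -- For `u ∈ C` the coefficient is a limit of those of `w n`, which vanish. For `u ∉ C` a nonzero
  -- coefficient of `x - d ∈ C` would put `u` in `C`.
  have hcoef : ∀ u ∈ unitaryNormalizer B, E ((x - d) * star u) = 0 := by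
    intro u hu
    by_cases huC : u ∈ C
    · have hlim : Filter.Tendsto (fun n => E ((z n - y n) * star u)) Filter.atTop
          (nhds (E ((x - d) * star u))) :=
        (hEc.tendsto _).comp ((hzx.sub hd).mul_const (star u))
      have hzero : ∀ n, E ((z n - y n) * star u) = 0 := by
        intro n
        rw [← hyw n, add_sub_cancel_left]
        have hmem : w n * star u ∈ Submodule.span ℂ (unitaryNormalizer B \ C) :=
          mem_span_of_mul_mem (S := unitaryNormalizer B \ C) (T := unitaryNormalizer B ∩ C)
            (U := unitaryNormalizer B \ C)
            (fun u hu v hv => ⟨mul_mem_normalizer hu.1 hv.1, mul_notMem hv hu.2⟩) (hw n)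
            (Submodule.subset_span ⟨star_mem_normalizer hu, star_mem huC⟩)
        exact (Submodule.span_le (p := LinearMap.ker E)).2
          (fun u hu => hE.map_normalizer hirr hu.1 fun h => hu.2 (hBC h)) hmem
      simp only [hzero] at hlim
      exact (tendsto_nhds_unique hlim tendsto_const_nhds)
    · by_contra h
      exact huC (mem_of_map_mul_star_ne_zero hBc hB hreg hirr hE hCc hBC (sub_mem hx hdC) hu h)
  have hall : E ((x - d) * star (x - d)) = 0 := by
    have hFc : Continuous (E ∘ₗ LinearMap.mulLeft ℂ (x - d)) :=
      hEc.comp (continuous_const_mul (x - d))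
    refine hreg.eq_zero_of_normalizer hFc (fun u hu => ?_) (star (x - d))
    simpa using hcoef (star u) (star_mem_normalizer hu)
  have hxd : star (x - d) = 0 := by
    refine hE.faithful hA hreg hirr ?_
    rwa [star_star]
  rw [sub_eq_zero.1 (star_eq_zero.1 hxd)]
  exact hdcl

end Intermediate

end RegularInclusion

theorem mainTheorem3 {A : Type*} [CStarAlgebra A]
    (B : StarSubalgebra ℂ A) (hBclosed : IsClosed (B : Set A))
    (hA : RegularInclusion.IsSimpleCStar A) (hB : RegularInclusion.IsSimpleCStar B)
    (hreg : RegularInclusion.IsRegular B) (hirr : RegularInclusion.IsIrreducible B)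
    (hE : ∃ E : A →ₗ[ℂ] B, RegularInclusion.IsConditionalExpectation B E)
    (C : StarSubalgebra ℂ A) (hCclosed : IsClosed (C : Set A)) (hBC : B ≤ C) :
    RegularInclusion.IsRegular (A := C) (B.comap C.subtype) := by
  let _ := CStarAlgebra.spectralOrder A
  have _ := CStarAlgebra.spectralOrderedRing A
  obtain ⟨E, hE⟩ := hE
  have hle := RegularInclusion.le_topologicalClosure_adjoin hBclosed hA hB hreg hirr
    hE.isCondExp hCclosed hBC
  -- Normalizing `B` is the same condition in `C` as in `A`, because `B ≤ C`.
  have hnorm : RegularInclusion.unitaryNormalizer B ∩ C ⊆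
      C.subtype '' RegularInclusion.unitaryNormalizer (B.comap C.subtype) := by
    rintro u ⟨hu, huC⟩
    have hu1 := Unitary.mem_iff.1 hu.1
    refine ⟨⟨u, huC⟩, ⟨Unitary.mem_iff.2 ⟨Subtype.ext hu1.1, Subtype.ext hu1.2⟩, ?_⟩, rfl⟩
    ext ⟨c, hc⟩
    constructor
    · rintro ⟨b, hb, h⟩
      have h' : u * (b : A) * star u = c := congrArg Subtype.val h
      change c ∈ B
      rw [← h']
      exact RegularInclusion.conj_mem_of_mem_normalizer hu hb
    · intro hcB
      have : c ∈ (fun b => u * b * star u) '' (B : Set A) := by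
        rw [hu.2]; exact hcB
      obtain ⟨b, hb, h⟩ := this
      exact ⟨⟨b, hBC hb⟩, hb, Subtype.ext h⟩
  have hmap : StarAlgebra.adjoin ℂ (RegularInclusion.unitaryNormalizer B ∩ C) ≤
      (StarAlgebra.adjoin ℂ (RegularInclusion.unitaryNormalizer (B.comap C.subtype))).map
        C.subtype := by
    rw [StarAlgebra.adjoin_le_iff]
    refine hnorm.trans ?_
    rw [StarSubalgebra.coe_map]
    exact Set.image_mono (StarAlgebra.subset_adjoin ℂ _)
  rw [RegularInclusion.IsRegular, eq_top_iff]
  intro c _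
  -- `C` carries the subspace topology, so density in `C` can be tested in `A`.
  rw [← SetLike.mem_coe, StarSubalgebra.topologicalClosure_coe, closure_subtype]
  have hc : (c : A) ∈ closure (StarAlgebra.adjoin ℂ
      (RegularInclusion.unitaryNormalizer B ∩ C) : Set A) := by
    rw [← StarSubalgebra.topologicalClosure_coe]
    exact hle c.2
  exact closure_mono hmap hc
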